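/- Let $\mathbb R_{\max}=\mathbb R\cup\{-\infty\}$ with $\oplus=\max$, $\otimes=+$, and let $k\ge 1$. Two vectors $u,v$ of $\mathbb R_{\max}^k$ are parallel if $u=a\otimes v$ for some $a\in\mathbb R$; let $\pi$ be the projection onto parallelism classes and $\mathbb{PR}^k$ the set of classes of vectors of $\mathbb R^k$. For $u,v\in\mathbb R^k$ put $d(u,v)=\max_i(u_i-v_i)+\max_i(v_i-u_i)$, and for a matrix $A\in\mathbb R_{\max}^{k\times k}$ let $\mathtt D(A)=\sup_{u,v\in\mathbb R^k}d(A\otimes u,A\otimes v)$ (and $\mathtt D(A)=+\infty$ if $A$ does not map $\mathbb R^k$ into $\mathbb R^k$). A matrix is of rank $r$ if it has $r$ pairwise non-parallel columns such that every other column is parallel to a $(\max,+)$-linear combination of them. Let $(\Omega,\mathcal F,P)$ be a probability space with an invertible bimeasurable $P$-preserving map $\theta:\Omega\to\Omega$, and let $\{A(n)\}_{n\ge 0}$ be random matrices with values in $\mathbb R_{\max}^{k\times k}$ and $A(n+1)=A(n)\circ\theta$. Assume that $\theta$ is ergodic or that the $A(n)$ are i.i.d., that almost surely every row of $A(0)$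 has an entry different from $-\infty$ (for instance, for $k\ge2$, that $A(0)$ is a.s. irreducible), and that $P\{\mathtt D(A(n)\otimes\cdots\otimes A(0))<+\infty\}>0$ for some $n\ge 0$. For $x_0\in\mathbb R^k$ let $x(0,x_0)=x_0$ and $x(n+1,x_0)=A(n)\otimes x(n,x_0)$. A stationary regime is a random variable $Z:\Omega\to\mathbb{PR}^k$ with $Z\circ\theta=\pi(A(0)\otimes\pi^{-1}(Z))$ a.s.; it is unique if any other stationary regime is a.s. equal to it. A deterministic matrix $C$ is a pattern of $\{A(n)\}$ if there is $N\ge1$ such that for every $\eta>0$, with positive probability all entries of $A(N-1)\otimes\cdots\otimes A(0)$ are at distance less than $\eta$ from those of $C$ (an entry being close to $-\infty$ only if it equals $-\infty$). Then the following are equivalent: 1. There is a unique stationary regime $Z$, and for every $x_0\in\mathbb R^k$ the sequence $\pi(x(n,x_0))$ couples with it in finite time: $P\big(\pi(x(n+l,x_0))=Z\circ\theta^{n+l}\ \ \forall l\ge 0\big)\to 1$ as $n\to\infty$. 2. There is a unique stationary regime $Z$, and the coupling is uniform over initial conditions: $P\big(\pi(x(n+l,x_0))=Z\circ\theta^{n+l}\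 \ \forall l\ge 0,\ \forall x_0\in\mathbb R^k\big)\to 1$ as $n\to\infty$. 3. There is a (measurable) set $\mathcal C$ of matrices such that every $C\in\mathcal C$ is of rank 1, every $C\in\mathcal C$ is a pattern of $\{A(n)\}$, and $P\big(A(N-1)\otimes\cdots\otimes A(0)\in\mathcal C\big)>0$ for some $N\ge 1$. -/

import Mathlib

open MeasureTheory ProbabilityTheory Filter Topology
open scoped ENNReal

noncomputable section

namespace MaxPlus

/-- The (max,+) semiring `ℝ ∪ {-∞}`: `⊔` is the addition `⊕`, the usual `+` is the
multiplication `⊗`, and `⊥ = -∞` is the zero `ε`. -/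
abbrev Rmax : Type := WithBot ℝ

/-- The Borel σ-algebra of `ℝ ∪ {-∞}`: a set is measurable iff its trace on `ℝ` is a Borel set. -/
instance : MeasurableSpace Rmax :=
  MeasurableSpace.map (fun r : ℝ => (r : Rmax)) inferInstance

/-- Square matrices of size `k` over the (max,+) semiring. -/
abbrev RMat (k : ℕ) : Type := Matrix (Fin k) (Fin k) Rmax

instance (k : ℕ) : MeasurableSpace (RMat k) :=
  inferInstanceAs (MeasurableSpace (Fin k → Fin k → Rmax))

variable {k : ℕ}

/-- A vector of `ℝᵏ` seen as a vector with entries in `ℝ ∪ {-∞}`. -/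
def ofReal (u : Fin k → ℝ) : Fin k → Rmax := fun i => (u i : Rmax)

/-- The scalar multiple `a ⊗ u`. -/
def smul (a : Rmax) (u : Fin k → Rmax) : Fin k → Rmax := fun i => a + u i

/-- The (max,+) product of two matrices: `(A ⊗ B) i j = max_l (A i l + B l j)`. -/
def mul (A B : RMat k) : RMat k := fun i j => Finset.univ.sup fun l => A i l + B l j

/-- The (max,+) product of a matrix and a vector: `(A ⊗ u) i = max_l (A i l + u l)`. -/
def mulVec (A : RMat k) (u : Fin k → Rmax) : Fin k → Rmax :=
  fun i => Finset.univ.sup fun l => A i l + u l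

/-- The (max,+) identity matrix: `0` on the diagonal and `-∞` elsewhere. -/
def idMat (k : ℕ) : RMat k := fun i j => if i = j then ((0 : ℝ) : Rmax) else ⊥

/-! ### The projective space -/

/-- Parallel vectors: `u = a ⊗ v` for some real number `a`. -/
def Parallel (u v : Fin k → Rmax) : Prop := ∃ a : ℝ, u = smul (a : Rmax) v

theorem coe_add_coe_neg (a : ℝ) (x : Rmax) : ((-a : ℝ) : Rmax) + ((a : Rmax) + x) = x := by
  rw [← add_assoc, ← WithBot.coe_add, neg_add_cancel, WithBot.coe_zero, zero_add]

theorem parallel_equivalence : Equivalence (Parallel (k := k)) where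
  refl u := ⟨0, by funext i; simp [smul]⟩
  symm := by
    rintro u v ⟨a, rfl⟩
    exact ⟨-a, by funext i; exact (coe_add_coe_neg a (v i)).symm⟩
  trans := by
    rintro u v w ⟨a, rfl⟩ ⟨b, rfl⟩
    exact ⟨a + b, by funext i; simp [smul, add_assoc]⟩

/-- The parallelism relation on vectors. -/
instance parallelSetoid (k : ℕ) : Setoid (Fin k → Rmax) := ⟨Parallel, parallel_equivalence⟩

/-- The projective space of `(ℝ ∪ {-∞})ᵏ`, with the quotient σ-algebra. -/
abbrev PRmax (k : ℕ) : Type := Quotient (parallelSetoid k)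

/-- The canonical projection `π`. -/
def proj (u : Fin k → Rmax) : PRmax k := Quotient.mk (parallelSetoid k) u

/-- The projective space of `ℝᵏ`: the classes of the vectors all of whose entries are finite. -/
def PR (k : ℕ) : Set (PRmax k) := Set.range fun u : Fin k → ℝ => proj (ofReal u)

theorem mulVec_smul (A : RMat k) (a : ℝ) (u : Fin k → Rmax) :
    mulVec A (smul (a : Rmax) u) = smul (a : Rmax) (mulVec A u) := by
  have hle : ∀ (b : ℝ) (v : Fin k → Rmax) (i : Fin k),
      mulVec A (smul (b : Rmax) v) i ≤ smul (b : Rmax) (mulVec A v) i := by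
    intro b v i
    refine Finset.sup_le fun l _ => ?_
    have h : A i l + v l ≤ mulVec A v i :=
      Finset.le_sup (f := fun l => A i l + v l) (Finset.mem_univ l)
    calc A i l + ((b : Rmax) + v l) = (b : Rmax) + (A i l + v l) := add_left_comm _ _ _
      _ ≤ (b : Rmax) + mulVec A v i := add_le_add le_rfl h
  funext i
  refine le_antisymm (hle a u i) ?_
  have h2 := hle (-a) (smul (a : Rmax) u) i
  have h3 : smul ((-a : ℝ) : Rmax) (smul (a : Rmax) u) = u := by
    funext j; exact coe_add_coe_neg a (u j)
  rw [h3] at h2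
  have h4 := coe_add_coe_neg (-a) (mulVec A (smul (a : Rmax) u) i)
  rw [neg_neg] at h4
  calc smul (a : Rmax) (mulVec A u) i
      ≤ (a : Rmax) + smul ((-a : ℝ) : Rmax) (mulVec A (smul (a : Rmax) u)) i :=
        add_le_add le_rfl h2
    _ = mulVec A (smul (a : Rmax) u) i := h4

/-- The action of a matrix on the projective space: `z ↦ π (A ⊗ π⁻¹ z)`. -/
def projMul (A : RMat k) : PRmax k → PRmax k :=
  Quotient.map (mulVec A) (by
    rintro u v ⟨a, rfl⟩
    exact ⟨a, mulVec_smul A a v⟩)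

/-! ### Projective distance and projective diameter -/

/-- The projective distance `max_i (u i - v i) + max_i (v i - u i)` of two vectors of `ℝᵏ`. -/
def projDist (u v : Fin k → ℝ) : ℝ := (⨆ i, (u i - v i)) + ⨆ i, (v i - u i)

open Classical in
/-- The projective diameter `sup_{u, v ∈ ℝᵏ} d (A ⊗ u, A ⊗ v)`; it is `∞` by convention when `A`
does not map `ℝᵏ` into `ℝᵏ`. -/
def projDiam (A : RMat k) : ℝ≥0∞ :=
  ⨆ (u : Fin k → ℝ) (v : Fin k → ℝ),
    if (∀ i, mulVec A (ofReal u) i ≠ ⊥) ∧ (∀ i, mulVec A (ofReal v) i ≠ ⊥) then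
      ENNReal.ofReal (projDist (fun i => (mulVec A (ofReal u) i).unbotD 0)
        (fun i => (mulVec A (ofReal v) i).unbotD 0))
    else ∞

/-! ### Rank -/

/-- The `i`-th column of a matrix. -/
def column (A : RMat k) (i : Fin k) : Fin k → Rmax := fun t => A t i

/-- `A` is of rank `r`: there is a set `J` of `r` indices such that the columns with index in `J`
are pairwise non-parallel and every other column is parallel to a (max,+) linear combination of
them. -/
def HasRank (A : RMat k) (r : ℕ) : Prop :=
  ∃ J : Finset (Fin k), J.card = r ∧
    (∀ i ∈ J, ∀ j ∈ J, i ≠ j → proj (column A i) ≠ proj (column A j)) ∧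
    ∀ i, i ∉ J → ∃ α : Fin k → Rmax,
      proj (column A i) = proj (fun t => J.sup fun j => smul (α j) (column A j) t)

/-! ### The stochastic recursive sequence -/

/-- The product `A (N-1) ⊗ ⋯ ⊗ A 0`. -/
def prod (A : ℕ → RMat k) : ℕ → RMat k
  | 0 => idMat k
  | N + 1 => mul (A N) (prod A N)

/-- The sequence `x (n+1) = A n ⊗ x n` with initial condition `x 0 = x₀ ∈ ℝᵏ`. -/
def traj (A : ℕ → RMat k) (x₀ : Fin k → ℝ) : ℕ → Fin k → Rmax
  | 0 => ofReal x₀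
  | n + 1 => mulVec (A n) (traj A x₀ n)

variable {Ω : Type*} [MeasurableSpace Ω]

/-- The ball of radius `η` around `M`: all the entries are at distance less than `η`, an entry
`-∞` being close to `-∞` only. -/
def ball (M : RMat k) (η : ℝ) : Set (RMat k) :=
  {N | ∀ i j, (M i j = ⊥ ∧ N i j = ⊥) ∨
    ∃ a b : ℝ, M i j = (a : Rmax) ∧ N i j = (b : Rmax) ∧ |b - a| < η}

/-- The deterministic matrix `C` is a pattern of the sequence of random matrices `A`: it belongs to
the support of some product `A (N-1) ⊗ ⋯ ⊗ A 0`. -/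
def IsPattern (μ : Measure Ω) (A : ℕ → Ω → RMat k) (C : RMat k) : Prop :=
  ∃ N : ℕ, 1 ≤ N ∧ ∀ η : ℝ, 0 < η → 0 < μ {ω | prod (fun n => A n ω) N ∈ ball C η}

/-- There are patterns of rank 1 with strictly positive probability. -/
def HasRankOnePatterns (μ : Measure Ω) (A : ℕ → Ω → RMat k) : Prop :=
  ∃ 𝒞 : Set (RMat k), MeasurableSet 𝒞 ∧
    (∀ C ∈ 𝒞, HasRank C 1) ∧
    (∀ C ∈ 𝒞, IsPattern μ A C) ∧
    ∃ N : ℕ, 1 ≤ N ∧ 0 < μ {ω | prod (fun n => A n ω) N ∈ 𝒞}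

/-- `Z` is a stationary regime of `π (x n)`: a random variable with values in the projective space
of `ℝᵏ` such that `Z ∘ θ = π (A 0 ⊗ π⁻¹ Z)` almost surely. -/
def IsStationaryRegime (μ : Measure Ω) (θ : Ω ≃ᵐ Ω) (A : ℕ → Ω → RMat k) (Z : Ω → PR k) : Prop :=
  Measurable Z ∧ ∀ᵐ ω ∂μ, (Z (θ ω) : PRmax k) = projMul (A 0 ω) (Z ω)

/-- `Z` is a stationary regime and, up to almost sure equality, it is the only one. -/
def IsUniqueStationaryRegime (μ : Measure Ω) (θ : Ω ≃ᵐ Ω) (A : ℕ → Ω → RMat k)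
    (Z : Ω → PR k) : Prop :=
  IsStationaryRegime μ θ A Z ∧ ∀ Z' : Ω → PR k, IsStationaryRegime μ θ A Z' → Z' =ᵐ[μ] Z

/-- Coupling in finite time with a unique stationary regime, for every initial condition:
`P (π (x (n+l, x₀)) = Z ∘ θ^(n+l) for all l ≥ 0) → 1` for every `x₀ ∈ ℝᵏ`. -/
def Couples (μ : Measure Ω) (θ : Ω ≃ᵐ Ω) (A : ℕ → Ω → RMat k) : Prop :=
  ∃ Z : Ω → PR k, IsUniqueStationaryRegime μ θ A Z ∧
    ∀ x₀ : Fin k → ℝ,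
      Tendsto (fun n : ℕ => μ {ω | ∀ l : ℕ,
        proj (traj (fun m => A m ω) x₀ (n + l)) = (Z (θ^[n + l] ω) : PRmax k)}) atTop (𝓝 1)

/-- Coupling in finite time with a unique stationary regime, uniformly over initial conditions:
`P (π (x (n+l, x₀)) = Z ∘ θ^(n+l) for all l ≥ 0 and all x₀ ∈ ℝᵏ) → 1`. -/
def CouplesUniformly (μ : Measure Ω) (θ : Ω ≃ᵐ Ω) (A : ℕ → Ω → RMat k) : Prop :=
  ∃ Z : Ω → PR k, IsUniqueStationaryRegime μ θ A Z ∧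
    Tendsto (fun n : ℕ => μ {ω | ∀ (x₀ : Fin k → ℝ) (l : ℕ),
      proj (traj (fun m => A m ω) x₀ (n + l)) = (Z (θ^[n + l] ω) : PRmax k)}) atTop (𝓝 1)

end MaxPlus

end

/-!
All the conditions are equivalent to the following one: with positive probability, some product
`A (N-1) ⊗ ⋯ ⊗ A 0` is of rank 1. Among the matrices that map `ℝᵏ` into `ℝᵏ`, those of rank 1 are
the outer products `c ⊗ r` (`IsOuter`). They collapse the projective space of `ℝᵏ` to a point
(`IsOuter.projMul_eq`) and they are stable under multiplication on both sides by matrices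
mapping `ℝᵏ` into `ℝᵏ`.

*Rank 1 implies uniform coupling.* By ergodicity, or by independence of disjoint blocks, almost
every orbit meets a block of rank 1 (`ae_exists_cocycle_iterate_mem`), so that `A (n-1) ⊗ ⋯ ⊗ A 0` is of
rank 1 for all large `n`, and by stationarity so is `A (-1) ⊗ ⋯ ⊗ A (-n)` for some `n`. The value
at time `0` of the recursion started far enough in the past therefore does not depend on the start:
this is the stationary regime (`backRegime`), and it is the only one. Forward in time, all the
trajectories agree with it as soon as `A (n-1) ⊗ ⋯ ⊗ A 0` is of rank 1.

*Coupling implies rank 1.* A matrix `M` of finite projective diameter has only columns that are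
finite or identically `-∞` (`column_ne_bot_of_projDiam_lt_top`), and if its finite entries are
bounded by `K`, then it maps the vector with `j`-th entry `2K` and other entries `0` to a multiple
of its `j`-th column, if this column is finite. With positive probability `M = A m ⊗ ⋯ ⊗ A 0` is of
this kind, with `K` deterministic. The trajectories started from these `k` deterministic vectors
couple with the same stationary regime, hence the columns of `A (n-1) ⊗ ⋯ ⊗ A 0` that are not
identically `-∞` are eventually parallel (`Couples.exists_isOuter`).

The matrices of rank 1 in the support of the law of a product that is of rank 1 with positive
probability are the required patterns; the support has full measure because rational balls form a
countable base (`exists_measurableSet_support`).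
-/

namespace MaxPlus

variable {k : ℕ}

/-! ### Algebra of (max,+) matrices -/

theorem add_finset_sup {ι : Type*} (s : Finset ι) (a : Rmax) (f : ι → Rmax) :
    a + s.sup f = s.sup fun i => a + f i := by
  classical
  induction s using Finset.induction_on with
  | empty => simp
  | insert i s _ ih => rw [Finset.sup_insert, Finset.sup_insert, ← ih]; exact add_max a _ _

theorem finset_sup_add {ι : Type*} (s : Finset ι) (a : Rmax) (f : ι → Rmax) :
    s.sup f + a = s.sup fun i => f i + a := by
  rw [add_comm, add_finset_sup]
  simp only [add_comm a]

theorem mulVec_mul (A B : RMat k) (u : Fin k → Rmax) :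
    mulVec (mul A B) u = mulVec A (mulVec B u) := by
  funext i
  simp only [mulVec, mul, add_finset_sup, finset_sup_add]
  rw [Finset.sup_comm]
  simp only [add_assoc]

theorem mul_assoc (A B C : RMat k) : mul (mul A B) C = mul A (mul B C) := by
  funext i j
  exact congrFun (mulVec_mul A B (column C j)) i

theorem mulVec_idMat (u : Fin k → Rmax) : mulVec (idMat k) u = u := by
  funext i
  refine le_antisymm (Finset.sup_le fun l _ => ?_) ?_
  · by_cases h : i = l <;> simp [idMat, h]
  · have := Finset.le_sup (f := fun l => idMat k i l + u l) (Finset.mem_univ i)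
    simp only [idMat, if_pos, WithBot.coe_zero, zero_add] at this
    exact this

theorem mul_idMat (A : RMat k) : mul A (idMat k) = A := by
  funext i j
  refine le_antisymm (Finset.sup_le fun l _ => ?_) ?_
  · by_cases h : l = j <;> simp [idMat, h]
  · have := Finset.le_sup (f := fun l => A i l + idMat k l j) (Finset.mem_univ j)
    simp only [idMat, if_pos, WithBot.coe_zero, add_zero] at this
    exact this

theorem prod_add (a : ℕ → RMat k) (m n : ℕ) :
    prod a (m + n) = mul (prod (fun i => a (m + i)) n) (prod a m) := by
  induction n with
  | zero =>
    funext i j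
    exact (congrFun (mulVec_idMat (column (prod a m) j)) i).symm
  | succ n ih => rw [← add_assoc, prod, ih, prod, mul_assoc]

theorem traj_eq_mulVec_prod (a : ℕ → RMat k) (x₀ : Fin k → ℝ) (n : ℕ) :
    traj a x₀ n = mulVec (prod a n) (ofReal x₀) := by
  induction n with
  | zero => rw [traj, prod, mulVec_idMat]
  | succ n ih => rw [traj, ih, prod, mulVec_mul]

theorem projMul_proj (A : RMat k) (u : Fin k → Rmax) : projMul A (proj u) = proj (mulVec A u) := rfl

theorem projMul_mul (A B : RMat k) (z : PRmax k) :
    projMul (mul A B) z = projMul A (projMul B z) := by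
  induction z using Quotient.inductionOn with
  | h u => exact congrArg proj (mulVec_mul A B u)

theorem projMul_idMat (z : PRmax k) : projMul (idMat k) z = z := by
  induction z using Quotient.inductionOn with
  | h u => exact congrArg proj (mulVec_idMat u)

theorem proj_eq_proj {u v : Fin k → Rmax} : proj u = proj v ↔ ∃ a : ℝ, u = smul (a : Rmax) v :=
  Quotient.eq

/-- No row of `M` is identically `-∞`; equivalently `M` maps `ℝᵏ` into `ℝᵏ`. -/
def RowFinite (M : RMat k) : Prop := ∀ i, ∃ j, M i j ≠ ⊥

theorem mulVec_eq_bot {M : RMat k} {u : Fin k → Rmax} {i : Fin k} :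
    mulVec M u i = ⊥ ↔ ∀ l, M i l = ⊥ ∨ u l = ⊥ := by
  simp [mulVec]

theorem RowFinite.mulVec_ne_bot {M : RMat k} (hM : RowFinite M) {u : Fin k → Rmax}
    (hu : ∀ i, u i ≠ ⊥) (i : Fin k) : mulVec M u i ≠ ⊥ := by
  rw [Ne, mulVec_eq_bot]
  intro h
  obtain ⟨j, hj⟩ := hM i
  exact (h j).elim hj (hu j)

theorem RowFinite.mul {M N : RMat k} (hM : RowFinite M) (hN : RowFinite N) :
    RowFinite (mul M N) := by
  intro i
  obtain ⟨l, hl⟩ := hM i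
  obtain ⟨j, hj⟩ := hN l
  refine ⟨j, fun h => ?_⟩
  exact (mulVec_eq_bot.1 (show mulVec M (column N j) i = ⊥ from h) l).elim hl hj

theorem rowFinite_idMat : RowFinite (idMat k) := fun i => ⟨i, by simp [idMat]⟩

theorem rowFinite_prod {a : ℕ → RMat k} (h : ∀ n, RowFinite (a n)) (n : ℕ) :
    RowFinite (prod a n) := by
  induction n with
  | zero => exact rowFinite_idMat
  | succ n ih => exact (h n).mul ih

theorem exists_ofReal_eq {u : Fin k → Rmax} (hu : ∀ i, u i ≠ ⊥) :
    ofReal (fun i => (u i).unbotD 0) = u := by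
  funext i
  obtain ⟨a, ha⟩ := WithBot.ne_bot_iff_exists.1 (hu i)
  simp [ofReal, ← ha]

theorem ofReal_ne_bot (u : Fin k → ℝ) (i : Fin k) : ofReal u i ≠ ⊥ := WithBot.coe_ne_bot

/-! ### Matrices that are constant on the projective space -/

/-- `M` is the outer product `c ⊗ r` of a finite column `c` and a row `r` that is not identically
`-∞`. Among the matrices without a row `-∞`, these are the ones of rank 1. -/
def IsOuter (M : RMat k) : Prop :=
  ∃ (c : Fin k → ℝ) (r : Fin k → Rmax), (∃ j, r j ≠ ⊥) ∧ ∀ i j, M i j = (c i : Rmax) + r j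

theorem IsOuter.mul_left {M B : RMat k} (hM : IsOuter M) (hB : RowFinite B) :
    IsOuter (mul B M) := by
  obtain ⟨c, r, hr, h⟩ := hM
  refine ⟨fun i => (mulVec B (ofReal c) i).unbotD 0, r, hr, fun i j => ?_⟩
  have := congrFun (exists_ofReal_eq (hB.mulVec_ne_bot (ofReal_ne_bot c))) i
  simp only [ofReal] at this
  rw [this]
  simp only [mul, mulVec, h, finset_sup_add, add_assoc, ofReal]

theorem IsOuter.mul_right {M B : RMat k} (hM : IsOuter M) (hB : RowFinite B) :
    IsOuter (mul M B) := by
  obtain ⟨c, r, ⟨l, hl⟩, h⟩ := hM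
  refine ⟨c, fun j => Finset.univ.sup fun l => r l + B l j, ?_, fun i j => ?_⟩
  · obtain ⟨j, hj⟩ := hB l
    refine ⟨j, fun h0 => ?_⟩
    have := (Finset.sup_eq_bot_iff _ _).1 h0 l (Finset.mem_univ l)
    simp only [WithBot.add_eq_bot] at this
    exact this.elim hl hj
  · simp only [mul, h, add_finset_sup, add_assoc]

/-- An outer product collapses the projective space of `ℝᵏ` to a point. -/
theorem IsOuter.projMul_eq {M : RMat k} (hM : IsOuter M) (z w : PR k) :
    projMul M z = projMul M w := by
  obtain ⟨c, r, ⟨l, hl⟩, h⟩ := hM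
  have key : ∀ z : PR k, projMul M z = proj (ofReal c) := by
    rintro ⟨_, u, rfl⟩
    have hs : (Finset.univ.sup fun j => r j + (u j : Rmax)) ≠ ⊥ := fun h0 => by
      have := (Finset.sup_eq_bot_iff _ _).1 h0 l (Finset.mem_univ l)
      simp [hl] at this
    obtain ⟨s, hs⟩ := WithBot.ne_bot_iff_exists.1 hs
    refine proj_eq_proj.2 ⟨s, ?_⟩
    funext i
    simp only [mulVec, h, smul, hs, ofReal, add_assoc, ← add_finset_sup]
    rw [add_comm]
  rw [key, key]

theorem HasRank.isOuter {M : RMat k} (h : HasRank M 1) (hM : RowFinite M) : IsOuter M := by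
  obtain ⟨J, hJ, -, h⟩ := h
  obtain ⟨j, rfl⟩ := Finset.card_eq_one.1 hJ
  have h' : ∀ l, ∃ b : Rmax, ∀ t, M t l = b + M t j := by
    intro l
    by_cases hl : l = j
    · exact ⟨0, fun t => by simp [hl]⟩
    · obtain ⟨α, hα⟩ := h l (by simpa using hl)
      obtain ⟨a, ha⟩ := proj_eq_proj.1 hα
      refine ⟨a + α j, fun t => ?_⟩
      have := congrFun ha t
      simpa [column, smul, add_assoc] using this
  choose b hb using h'
  have hj : ∀ t, M t j ≠ ⊥ := by
    intro t ht
    obtain ⟨l, hl⟩ := hM t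
    exact hl (by rw [hb, ht, WithBot.add_bot])
  refine ⟨fun t => (M t j).unbotD 0, b, ⟨j, fun h0 => ?_⟩, fun t l => ?_⟩
  · have := hb j j
    rw [h0, WithBot.bot_add] at this
    exact hj j this
  · have := congrFun (exists_ofReal_eq hj) t
    simp only [ofReal] at this
    rw [this, hb, add_comm]

theorem IsOuter.hasRank {M : RMat k} (h : IsOuter M) : HasRank M 1 := by
  obtain ⟨c, r, ⟨j, hj⟩, h⟩ := h
  obtain ⟨s, hs⟩ := WithBot.ne_bot_iff_exists.1 hj
  refine ⟨{j}, by simp, by simp, fun i _ => ⟨fun _ => r i + ((-s : ℝ) : Rmax), ?_⟩⟩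
  congr 1
  funext t
  simp only [column, smul, h, Finset.sup_singleton, ← hs]
  rw [add_comm (c t : Rmax) (s : Rmax), add_assoc, coe_add_coe_neg, add_comm]

/-! ### Measurability -/

section Measurability

variable {α : Type*} [MeasurableSpace α]

theorem measurable_coe_rmax : Measurable (fun r : ℝ => (r : Rmax)) := fun _ h => h

theorem measurable_of_comp_coe {β : Type*} [MeasurableSpace β] {f : Rmax → β}
    (h : Measurable fun r : ℝ => f r) : Measurable f := fun _ hs => h hs

theorem measurable_unbotD : Measurable (WithBot.unbotD 0 : Rmax → ℝ) :=
  measurable_of_comp_coe measurable_id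

theorem measurableSet_bot : MeasurableSet ({⊥} : Set Rmax) := by
  change MeasurableSet ((fun r : ℝ => (r : Rmax)) ⁻¹' {⊥})
  convert MeasurableSet.empty
  ext r
  simp

theorem measurableSet_eq_bot {f : α → Rmax} (hf : Measurable f) : MeasurableSet {x | f x = ⊥} :=
  hf measurableSet_bot

theorem measurable_rmax {f : α → Rmax} (h : MeasurableSet {x | f x = ⊥})
    (h' : Measurable fun x => (f x).unbotD 0) : Measurable f := by
  classical
  have : f = fun x => if f x = ⊥ then ⊥ else (((f x).unbotD 0 : ℝ) : Rmax) := by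
    funext x
    induction f x using WithBot.recBotCoe <;> simp
  rw [this]
  exact Measurable.ite h measurable_const (measurable_coe_rmax.comp h')

theorem measurable_rmax_add {f g : α → Rmax} (hf : Measurable f) (hg : Measurable g) :
    Measurable fun x => f x + g x := by
  classical
  have hs : MeasurableSet {x | f x = ⊥ ∨ g x = ⊥} :=
    (measurableSet_eq_bot hf).union (measurableSet_eq_bot hg)
  refine measurable_rmax (by simpa using hs) ?_
  have : (fun x => (f x + g x).unbotD 0) =
      fun x => if f x = ⊥ ∨ g x = ⊥ then 0 else (f x).unbotD 0 + (g x).unbotD 0 := by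
    funext x
    induction f x using WithBot.recBotCoe <;> induction g x using WithBot.recBotCoe <;>
      simp [← WithBot.coe_add]
  rw [this]
  exact Measurable.ite hs measurable_const
    ((measurable_unbotD.comp hf).add (measurable_unbotD.comp hg))

theorem measurable_rmax_sup {f g : α → Rmax} (hf : Measurable f) (hg : Measurable g) :
    Measurable fun x => f x ⊔ g x := by
  classical
  refine measurable_rmax ?_ ?_
  · simp only [max_eq_bot]
    exact (measurableSet_eq_bot hf).inter (measurableSet_eq_bot hg)
  have : (fun x => (f x ⊔ g x).unbotD 0) = fun x => if f x = ⊥ then (g x).unbotD 0 else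
      if g x = ⊥ then (f x).unbotD 0 else (f x).unbotD 0 ⊔ (g x).unbotD 0 := by
    funext x
    induction f x using WithBot.recBotCoe with
    | bot => simp
    | coe a =>
      induction g x using WithBot.recBotCoe with
      | bot => simp
      | coe b =>
        rw [if_neg WithBot.coe_ne_bot, if_neg WithBot.coe_ne_bot, ← WithBot.coe_sup]
        rfl
  rw [this]
  have hf' := measurable_unbotD.comp hf
  have hg' := measurable_unbotD.comp hg
  exact Measurable.ite (measurableSet_eq_bot hf) hg'
    (Measurable.ite (measurableSet_eq_bot hg) hf' (hf'.sup hg'))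

theorem measurable_rmax_finset_sup {ι : Type*} (s : Finset ι) {f : ι → α → Rmax}
    (hf : ∀ i, Measurable (f i)) : Measurable fun x => s.sup fun i => f i x := by
  classical
  induction s using Finset.induction_on with
  | empty => simp
  | insert i s _ ih =>
    simp only [Finset.sup_insert]
    exact measurable_rmax_sup (hf i) ih

theorem measurableSet_rmax_eq {f g : α → Rmax} (hf : Measurable f) (hg : Measurable g) :
    MeasurableSet {x | f x = g x} := by
  have : {x | f x = g x} = ({x | f x = ⊥} ∩ {x | g x = ⊥}) ∪
      (({x | f x = ⊥} ∪ {x | g x = ⊥})ᶜ ∩ {x | (f x).unbotD 0 = (g x).unbotD 0}) := by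
    ext x
    simp only [Set.mem_ofPred_eq, Set.mem_union, Set.mem_inter_iff, Set.mem_compl_iff]
    induction f x using WithBot.recBotCoe <;> induction g x using WithBot.recBotCoe <;> simp
  rw [this]
  have hf' := measurableSet_eq_bot hf
  have hg' := measurableSet_eq_bot hg
  exact (hf'.inter hg').union ((hf'.union hg').compl.inter
    (measurableSet_eq_fun (measurable_unbotD.comp hf) (measurable_unbotD.comp hg)))

theorem measurable_entry (i j : Fin k) : Measurable fun M : RMat k => M i j :=
  (measurable_pi_apply (X := fun _ => Rmax) j).comp
    (measurable_pi_apply (X := fun _ => Fin k → Rmax) i)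

theorem measurable_rmat {f : α → RMat k} (h : ∀ i j, Measurable fun x => f x i j) :
    Measurable f :=
  measurable_pi_iff.2 fun i => measurable_pi_iff.2 fun j => h i j

theorem measurable_mul {f g : α → RMat k} (hf : Measurable f) (hg : Measurable g) :
    Measurable fun x => mul (f x) (g x) :=
  measurable_rmat fun i j => measurable_rmax_finset_sup _ fun l =>
    measurable_rmax_add ((measurable_entry i l).comp hf) ((measurable_entry l j).comp hg)

theorem measurable_mulVec {f : α → RMat k} (hf : Measurable f) (u : Fin k → Rmax) :
    Measurable fun x => mulVec (f x) u :=
  measurable_pi_iff.2 fun i => measurable_rmax_finset_sup _ fun l =>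
    measurable_rmax_add ((measurable_entry i l).comp hf) measurable_const

theorem measurable_prod {a : ℕ → α → RMat k} {n : ℕ} (h : ∀ i < n, Measurable (a i)) :
    Measurable fun x => prod (fun i => a i x) n := by
  induction n with
  | zero => exact measurable_const
  | succ n ih => exact measurable_mul (h n (by omega)) (ih fun i hi => h i (by omega))

/-- Outer products are characterised by the vanishing of the (max,+) analogue of the `2 × 2`
minors through a finite column. -/
theorem isOuter_iff [NeZero k] {M : RMat k} :
    IsOuter M ↔ ∃ j, (∀ i, M i j ≠ ⊥) ∧ ∀ i i' l, M i l + M i' j = M i j + M i' l := by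
  constructor
  · rintro ⟨c, r, ⟨j, hj⟩, h⟩
    refine ⟨j, fun i => by simp [h, hj], fun i i' l => ?_⟩
    simp only [h]
    abel
  · rintro ⟨j, hj, h⟩
    obtain ⟨s, hs⟩ := WithBot.ne_bot_iff_exists.1 (hj 0)
    refine ⟨fun i => (M i j).unbotD 0, fun l => ((-s : ℝ) : Rmax) + M 0 l, ⟨j, by simp [hj]⟩, ?_⟩
    intro i l
    have := congrFun (exists_ofReal_eq hj) i
    simp only [ofReal] at this
    rw [this, add_left_comm, ← h i 0 l, ← hs, add_comm (M i l), coe_add_coe_neg]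

theorem measurableSet_isOuter [NeZero k] : MeasurableSet {M : RMat k | IsOuter M} := by
  simp only [isOuter_iff, Set.ofPred_exists, Set.ofPred_and, Set.ofPred_forall]
  refine MeasurableSet.iUnion fun j => (MeasurableSet.iInter fun i => ?_).inter
    (MeasurableSet.iInter fun i => MeasurableSet.iInter fun i' => MeasurableSet.iInter fun l =>
      measurableSet_rmax_eq
        (measurable_rmax_add (measurable_entry i l) (measurable_entry i' j))
        (measurable_rmax_add (measurable_entry i j) (measurable_entry i' l)))
  exact (measurableSet_eq_bot (measurable_entry i j)).compl

/-! ### The support of the law of a random matrix -/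

theorem mem_ball_iff {M N : RMat k} {η : ℝ} (hη : 0 < η) : N ∈ ball M η ↔
    ∀ i j, (N i j = ⊥ ↔ M i j = ⊥) ∧ |(N i j).unbotD 0 - (M i j).unbotD 0| < η := by
  refine forall_congr' fun i => forall_congr' fun j => ?_
  induction M i j using WithBot.recBotCoe <;> induction N i j using WithBot.recBotCoe <;>
    simp [hη]

theorem measurableSet_ball (M : RMat k) {η : ℝ} (hη : 0 < η) : MeasurableSet (ball M η) := by
  have : ball M η = ⋂ i, ⋂ j, {N | N i j = ⊥ ↔ M i j = ⊥} ∩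
      {N | |(N i j).unbotD 0 - (M i j).unbotD 0| < η} := by
    ext N
    simp only [mem_ball_iff hη, Set.mem_iInter]
    rfl
  rw [this]
  refine MeasurableSet.iInter fun i => MeasurableSet.iInter fun j => MeasurableSet.inter ?_ ?_
  · by_cases h : M i j = ⊥
    · simpa [h] using measurableSet_eq_bot (measurable_entry i j)
    · simp only [h, iff_false]
      exact (measurableSet_eq_bot (measurable_entry i j)).compl
  · exact measurableSet_lt (((measurable_unbotD.comp (measurable_entry i j)).sub_const _).abs)
      measurable_const

/-- Matrices with entries in `ℚ ∪ {-∞}`, a countable family that meets every ball. -/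
def ratMat (q : Fin k → Fin k → Option ℚ) : RMat k :=
  fun i j => (q i j).elim ⊥ fun r => ((r : ℝ) : Rmax)

theorem exists_ratMat_mem_ball (M : RMat k) {η : ℝ} (hη : 0 < η) :
    ∃ q : Fin k → Fin k → Option ℚ, ratMat q ∈ ball M η := by
  have : ∀ i j, ∃ o : Option ℚ,
      ((o.elim ⊥ fun r : ℚ => ((r : ℝ) : Rmax)) = ⊥ ↔ M i j = ⊥) ∧
        |((o.elim ⊥ fun r : ℚ => ((r : ℝ) : Rmax)) : Rmax).unbotD 0 - (M i j).unbotD 0| < η := by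
    intro i j
    induction M i j using WithBot.recBotCoe with
    | bot => exact ⟨none, by simpa using hη⟩
    | coe a =>
      obtain ⟨r, hr⟩ := exists_rat_near a hη
      exact ⟨some r, by simpa [abs_sub_comm] using hr⟩
  choose q hq using this
  exact ⟨q, (mem_ball_iff hη).2 hq⟩

/-- A measure on matrices is carried by a measurable set of points all of whose balls have
positive measure: one removes the countably many rational balls that are null. -/
theorem exists_measurableSet_support (ν : Measure (RMat k)) :
    ∃ S : Set (RMat k), MeasurableSet S ∧ ν Sᶜ = 0 ∧
      ∀ C ∈ S, ∀ η : ℝ, 0 < η → 0 < ν (ball C η) := by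
  let b : (Fin k → Fin k → Option ℚ) × ℕ → Set (RMat k) := fun p =>
    ball (ratMat p.1) (1 / (p.2 + 1))
  have hpos : ∀ n : ℕ, (0 : ℝ) < 1 / (n + 1) := fun n => Nat.one_div_pos_of_nat
  let I := {p | ν (b p) = 0}
  refine ⟨(⋃ p ∈ I, b p)ᶜ, (MeasurableSet.biUnion (Set.to_countable I) fun p _ =>
    measurableSet_ball _ (hpos p.2)).compl, ?_, fun C hC η hη => ?_⟩
  · rw [compl_compl]
    exact (measure_biUnion_null_iff (Set.to_countable I)).2 fun p hp => hp
  · obtain ⟨n, hn⟩ := exists_nat_one_div_lt (half_pos hη)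
    obtain ⟨q, hq⟩ := exists_ratMat_mem_ball C (hpos n)
    rw [mem_ball_iff (hpos n)] at hq
    have hCb : C ∈ b (q, n) := (mem_ball_iff (hpos n)).2 fun i j =>
      ⟨(hq i j).1.symm, by rw [abs_sub_comm]; exact (hq i j).2⟩
    have hne : ν (b (q, n)) ≠ 0 := fun h0 => hC (Set.mem_biUnion (show (q, n) ∈ I from h0) hCb)
    refine (pos_iff_ne_zero.2 hne).trans_le (measure_mono fun N hN => ?_)
    rw [mem_ball_iff hη]
    intro i j
    have h1 := (mem_ball_iff (hpos n)).1 hN i j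
    refine ⟨h1.1.trans (hq i j).1, ?_⟩
    have h2 := abs_sub_le ((N i j).unbotD 0) ((ratMat q i j).unbotD 0) ((C i j).unbotD 0)
    have h3 := h1.2
    have h4 := (hq i j).2
    linarith

/-! ### Measurable representatives of projective classes -/

open Classical in
/-- The representative, with entry `0` at the index `0`, of a projective class of `ℝᵏ`. On the
other classes the value is a junk one, chosen to be measurable. -/
noncomputable def section₀ [NeZero k] : PRmax k → Fin k → ℝ :=
  Quotient.lift (fun u i => if u i = ⊥ ∨ u 0 = ⊥ then 0 else (u i).unbotD 0 - (u 0).unbotD 0) (by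
    rintro u v ⟨a, rfl⟩
    funext i
    simp only [smul]
    have key : ∀ x y : Rmax, (if (a : Rmax) + x = ⊥ ∨ (a : Rmax) + y = ⊥ then (0 : ℝ)
        else ((a : Rmax) + x).unbotD 0 - ((a : Rmax) + y).unbotD 0) =
          if x = ⊥ ∨ y = ⊥ then 0 else x.unbotD 0 - y.unbotD 0 := by
      intro x y
      induction x using WithBot.recBotCoe <;> induction y using WithBot.recBotCoe <;>
        simp [← WithBot.coe_add]
    exact key (v i) (v 0))

theorem measurable_section₀ [NeZero k] : Measurable (section₀ (k := k)) := by
  classical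
  refine measurable_from_quotient.2 (measurable_pi_iff.2 fun i => ?_)
  have h : ∀ i : Fin k, Measurable fun u : Fin k → Rmax => u i := fun i => measurable_pi_apply i
  exact Measurable.ite ((measurableSet_eq_bot (h i)).union (measurableSet_eq_bot (h 0)))
    measurable_const ((measurable_unbotD.comp (h i)).sub (measurable_unbotD.comp (h 0)))

theorem proj_section₀ [NeZero k] (z : PR k) : proj (ofReal (section₀ (z : PRmax k))) = z := by
  obtain ⟨_, u, rfl⟩ := z
  refine proj_eq_proj.2 ⟨-u 0, ?_⟩
  funext i
  simp [section₀, proj, ofReal, smul, ← WithBot.coe_add, neg_add_eq_sub]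

theorem measurable_proj : Measurable (proj : (Fin k → Rmax) → PRmax k) := fun _ h => h

theorem measurableSet_proj_eq [NeZero k] {f : α → Fin k → Rmax} (hf : Measurable f)
    {Z : α → PR k} (hZ : Measurable Z) : MeasurableSet {x | proj (f x) = (Z x : PRmax k)} := by
  have hf' : ∀ i, Measurable fun x => f x i := measurable_pi_iff.1 hf
  have : {x | proj (f x) = (Z x : PRmax k)} = (⋂ i, {x | f x i = ⊥}ᶜ) ∩
      {x | section₀ (proj (f x)) = section₀ (Z x : PRmax k)} := by
    ext x
    simp only [Set.mem_inter_iff, Set.mem_iInter, Set.mem_compl_iff]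
    constructor
    · refine fun h => ⟨fun i => ?_, congrArg section₀ h⟩
      rw [Set.mem_ofPred_eq, ← proj_section₀ (Z x)] at h
      obtain ⟨a, ha⟩ := proj_eq_proj.1 h
      rw [Set.mem_ofPred_eq, ha]
      simp [smul, ofReal]
    · rintro ⟨h, h'⟩
      have := proj_section₀ (⟨proj (f x), _, congrArg proj (exists_ofReal_eq h)⟩ : PR k)
      rw [Set.mem_ofPred_eq, ← proj_section₀ (Z x)]
      refine this.symm.trans ?_
      exact congrArg (fun u => proj (ofReal u)) h'
  rw [this]
  exact (MeasurableSet.iInter fun i => (measurableSet_eq_bot (hf' i)).compl).inter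
    (measurableSet_eq_fun (measurable_section₀.comp (measurable_proj.comp hf))
      (measurable_section₀.comp (measurable_subtype_coe.comp hZ)))

end Measurability

/-! ### The cocycle of products and its recurrence -/

/-- The random product `A (n-1) ⊗ ⋯ ⊗ A 0`. -/
noncomputable def cocycle {Ω : Type*} (A : ℕ → Ω → RMat k) (n : ℕ) (ω : Ω) : RMat k :=
  prod (fun m => A m ω) n

theorem cocycle_one {Ω : Type*} (A : ℕ → Ω → RMat k) (ω : Ω) : cocycle A 1 ω = A 0 ω :=
  mul_idMat _

section Cocycle

variable {Ω : Type*} [MeasurableSpace Ω] {μ : Measure Ω} {θ : Ω ≃ᵐ Ω} {A : ℕ → Ω → RMat k}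

theorem shift_iterate (hshift : ∀ n ω, A (n + 1) ω = A n (θ ω)) (m i : ℕ) (ω : Ω) :
    A (m + i) ω = A i (θ^[m] ω) := by
  induction m generalizing ω with
  | zero => simp
  | succ m ih => rw [add_right_comm, hshift, ih, Function.iterate_succ_apply]

theorem cocycle_iterate (hshift : ∀ n ω, A (n + 1) ω = A n (θ ω)) (m n : ℕ) (ω : Ω) :
    cocycle A n (θ^[m] ω) = prod (fun i => A (m + i) ω) n := by
  simp only [cocycle, shift_iterate hshift]

theorem cocycle_add (hshift : ∀ n ω, A (n + 1) ω = A n (θ ω)) (m n : ℕ) (ω : Ω) :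
    cocycle A (m + n) ω = mul (cocycle A n (θ^[m] ω)) (cocycle A m ω) := by
  rw [cocycle_iterate hshift]
  exact prod_add _ m n

theorem measurable_cocycle (hmeas : ∀ n, Measurable (A n)) (n : ℕ) : Measurable (cocycle A n) :=
  measurable_prod fun i _ => hmeas i

theorem ae_rowFinite (hθ : MeasurePreserving θ μ μ)
    (hshift : ∀ n ω, A (n + 1) ω = A n (θ ω)) (hrow : ∀ i, ∀ᵐ ω ∂μ, ∃ j, A 0 ω i j ≠ ⊥) :
    ∀ᵐ ω ∂μ, ∀ n, RowFinite (A n ω) := by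
  have h0 : ∀ᵐ ω ∂μ, RowFinite (A 0 ω) := ae_all_iff.2 hrow
  refine ae_all_iff.2 fun n => ?_
  filter_upwards [(hθ.iterate n).quasiMeasurePreserving.ae h0] with ω hω
  rwa [← shift_iterate hshift n 0] at hω

/-- An event of positive probability depending on a block of matrices occurs along almost every
orbit. For i.i.d. matrices, the event `F` that it never occurs is contained both in the event that
it does not occur in the first block and in the event, independent of the former and with the same
probability as `F`, that it never occurs after the first block; so `F` is null. -/
theorem ae_exists_cocycle_iterate_mem [IsProbabilityMeasure μ] (hθ : MeasurePreserving θ μ μ)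
    (hmeas : ∀ n, Measurable (A n)) (hshift : ∀ n ω, A (n + 1) ω = A n (θ ω))
    (hA : Ergodic θ μ ∨ iIndepFun A μ) {S : Set (RMat k)} (hS : MeasurableSet S) {N : ℕ}
    (hpos : 0 < μ {ω | cocycle A N ω ∈ S}) :
    ∀ᵐ ω ∂μ, ∃ m, cocycle A N (θ^[m] ω) ∈ S := by
  have hE : MeasurableSet {ω | cocycle A N ω ∈ S} := measurable_cocycle hmeas N hS
  set E := {ω | cocycle A N ω ∈ S}
  rcases hA with herg | hind
  · let T : Set Ω := ⋃ m, θ^[m] ⁻¹' E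
    have hT : MeasurableSet T := MeasurableSet.iUnion fun m => (θ.measurable.iterate m) hE
    have hsub : θ ⁻¹' T ⊆ T := by
      intro ω hω
      obtain ⟨m, hm⟩ := Set.mem_iUnion.1 hω
      exact Set.mem_iUnion.2 ⟨m + 1, hm⟩
    rcases herg.ae_empty_or_univ_of_preimage_ae_le hT.nullMeasurableSet
      hsub.eventuallyLE with h | h
    · have hle : μ E ≤ μ T := measure_mono (Set.subset_iUnion (fun m => θ^[m] ⁻¹' E) 0)
      rw [measure_congr h, measure_empty] at hle
      exact absurd hle (not_le.2 hpos)
    · filter_upwards [h.mem_iff] with ω hω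
      exact Set.mem_iUnion.1 (hω.2 trivial)
  · let m' : ℕ → MeasurableSpace Ω := fun n => MeasurableSpace.comap (A n) inferInstance
    have hle : ∀ n, m' n ≤ ‹MeasurableSpace Ω› := fun n => (hmeas n).comap_le
    have hdisj : Disjoint (Set.Iio N) (Set.Ici N) := Set.Iio_disjoint_Ici le_rfl
    have hI := (Indep_iff _ _ μ).1
      (indep_iSup_of_disjoint hle ((iIndepFun_iff_iIndep _ _ _).1 hind) hdisj)
    have hA' : ∀ (T : Set ℕ), ∀ n ∈ T, Measurable[⨆ i ∈ T, m' i] (A n) := fun T n hn =>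
      (comap_measurable (A n)).mono (le_iSup₂_of_le n hn le_rfl) le_rfl
    let F : Set Ω := {ω | ∀ m, cocycle A N (θ^[m] ω) ∉ S}
    have hF : MeasurableSet F := by
      have : F = ⋂ m, (θ^[m] ⁻¹' E)ᶜ := by ext ω; simp [F, E]
      rw [this]
      exact MeasurableSet.iInter fun m => ((θ.measurable.iterate m) hE).compl
    have hE' : MeasurableSet[⨆ i ∈ Set.Iio N, m' i] Eᶜ :=
      (@measurable_prod k Ω (⨆ i ∈ Set.Iio N, m' i) A N (fun i hi => hA' _ i hi) _ hS).compl
    have hG : MeasurableSet[⨆ i ∈ Set.Ici N, m' i] (θ^[N] ⁻¹' F) := by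
      have : θ^[N] ⁻¹' F = ⋂ m, {ω | prod (fun i => A (N + m + i) ω) N ∈ S}ᶜ := by
        ext ω
        simp only [F, Set.mem_preimage, Set.mem_ofPred_eq, Set.mem_iInter, Set.mem_compl_iff,
          cocycle_iterate hshift, ← shift_iterate hshift, add_assoc]
      rw [this]
      refine MeasurableSet.iInter fun m => MeasurableSet.compl ?_
      exact @measurable_prod k Ω (⨆ i ∈ Set.Ici N, m' i) (fun i => A (N + m + i)) N
        (fun i _ => hA' _ _ (by rw [Set.mem_Ici]; omega)) _ hS
    have hmul := hI _ _ hE' hG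
    rw [(hθ.iterate N).measure_preimage hF.nullMeasurableSet] at hmul
    have hsub : F ⊆ Eᶜ ∩ θ^[N] ⁻¹' F := fun ω hω =>
      ⟨hω 0, fun m => by rw [← Function.iterate_add_apply]; exact hω _⟩
    have hle := (measure_mono hsub).trans hmul.le
    have hlt : μ Eᶜ < 1 := by
      rw [prob_compl_eq_one_sub hE]
      exact ENNReal.sub_lt_self ENNReal.one_ne_top one_ne_zero hpos.ne'
    have hF0 : μ F = 0 := by
      by_contra h0
      have := ENNReal.mul_lt_mul_left h0 (measure_ne_top μ F) hlt
      rw [one_mul] at this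
      exact absurd hle (not_le.2 this)
    filter_upwards [measure_eq_zero_iff_ae_notMem.1 hF0] with ω hω
    simpa [F] using hω

/-- If some product has rank 1 with positive probability, then almost surely the products
`A (n-1) ⊗ ⋯ ⊗ A 0` are eventually of rank 1. -/
theorem ae_exists_isOuter_cocycle [NeZero k] [IsProbabilityMeasure μ]
    (hθ : MeasurePreserving θ μ μ) (hmeas : ∀ n, Measurable (A n))
    (hshift : ∀ n ω, A (n + 1) ω = A n (θ ω)) (hA : Ergodic θ μ ∨ iIndepFun A μ)
    (hrow : ∀ i, ∀ᵐ ω ∂μ, ∃ j, A 0 ω i j ≠ ⊥) {N : ℕ}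
    (hpos : 0 < μ {ω | IsOuter (cocycle A N ω)}) :
    ∀ᵐ ω ∂μ, ∃ n, ∀ m, n ≤ m → IsOuter (cocycle A m ω) := by
  filter_upwards [ae_rowFinite hθ hshift hrow,
    ae_exists_cocycle_iterate_mem hθ hmeas hshift hA measurableSet_isOuter hpos] with ω h1 h2
  obtain ⟨m, hm⟩ := h2
  refine ⟨m + N, fun n hn => ?_⟩
  obtain ⟨l, rfl⟩ := Nat.exists_eq_add_of_le hn
  rw [cocycle_add hshift, cocycle_add hshift m N]
  refine (IsOuter.mul_right hm (rowFinite_prod h1 m)).mul_left ?_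
  rw [cocycle_iterate hshift]
  exact rowFinite_prod (fun i => h1 _) l

theorem tendsto_measure_isOuter_cocycle [NeZero k] [IsProbabilityMeasure μ]
    (h : ∀ᵐ ω ∂μ, ∃ n, ∀ m, n ≤ m → IsOuter (cocycle A m ω)) :
    Tendsto (fun n => μ {ω | ∀ m, n ≤ m → IsOuter (cocycle A m ω)}) atTop (𝓝 1) := by
  have hmono : Monotone fun n => {ω | ∀ m, n ≤ m → IsOuter (cocycle A m ω)} :=
    fun n n' hn ω hω m hm => hω m (hn.trans hm)
  have := tendsto_measure_iUnion_atTop (μ := μ) hmono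
  rwa [show (⋃ n, {ω | ∀ m, n ≤ m → IsOuter (cocycle A m ω)}) =
    {ω | ∃ n, ∀ m, n ≤ m → IsOuter (cocycle A m ω)} by ext; simp,
    show μ {ω | ∃ n, ∀ m, n ≤ m → IsOuter (cocycle A m ω)} = 1 from
      (measure_congr (eventuallyEq_univ.2 h)).trans measure_univ] at this

/-! ### The stationary regime -/

theorem iterate_symm_iterate_add (m n : ℕ) (ω : Ω) :
    θ^[m] (θ.symm^[m + n] ω) = θ.symm^[n] ω := by
  rw [Function.iterate_add_apply]
  exact Function.RightInverse.iterate (f := θ) (fun x => θ.apply_symm_apply x) m _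

/-- Almost surely one of the products `A (-1) ⊗ ⋯ ⊗ A (-n)` ending at time `0` is of rank 1: they
have the same laws as the products starting at time `0`. -/
theorem ae_exists_isOuter_cocycle_symm [NeZero k] [IsProbabilityMeasure μ]
    (hθ : MeasurePreserving θ μ μ) (hmeas : ∀ n, Measurable (A n))
    (h : ∀ᵐ ω ∂μ, ∃ n, ∀ m, n ≤ m → IsOuter (cocycle A m ω)) :
    ∀ᵐ ω ∂μ, ∃ n, IsOuter (cocycle A n (θ.symm^[n] ω)) := by
  have hmeas' : ∀ n, MeasurableSet {ω | IsOuter (cocycle A n ω)} := fun n =>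
    measurable_cocycle hmeas n measurableSet_isOuter
  have hG : MeasurableSet {ω | ∃ n, IsOuter (cocycle A n (θ.symm^[n] ω))} := by
    rw [Set.ofPred_exists]
    exact MeasurableSet.iUnion fun n => (θ.symm.measurable.iterate n) (hmeas' n)
  refine (prob_compl_eq_zero_iff hG).2 (le_antisymm prob_le_one ?_)
  refine le_of_tendsto (tendsto_measure_isOuter_cocycle h) (Eventually.of_forall fun n => ?_)
  calc μ {ω | ∀ m, n ≤ m → IsOuter (cocycle A m ω)}
      ≤ μ {ω | IsOuter (cocycle A n ω)} := measure_mono fun ω hω => hω n le_rfl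
    _ = μ (θ.symm^[n] ⁻¹' {ω | IsOuter (cocycle A n ω)}) :=
        ((hθ.symm.iterate n).measure_preimage (hmeas' n).nullMeasurableSet).symm
    _ ≤ μ {ω | ∃ n, IsOuter (cocycle A n (θ.symm^[n] ω))} := measure_mono fun ω hω => ⟨n, hω⟩

open Classical in
/-- The smallest `n` such that `A (-1) ⊗ ⋯ ⊗ A (-n)` is of rank 1 (`0` if there is none). -/
noncomputable def backTime (θ : Ω ≃ᵐ Ω) (A : ℕ → Ω → RMat k) (ω : Ω) : ℕ :=
  if h : ∃ n, IsOuter (cocycle A n (θ.symm^[n] ω)) then Nat.find h else 0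

/-- The vector `A (-1) ⊗ ⋯ ⊗ A (-n) ⊗ 0`, where `n` is `backTime`; entries `-∞`, which occur on a
null event only, are replaced by `0`. -/
noncomputable def backVec (θ : Ω ≃ᵐ Ω) (A : ℕ → Ω → RMat k) (ω : Ω) : Fin k → ℝ := fun i =>
  (mulVec (cocycle A (backTime θ A ω) (θ.symm^[backTime θ A ω] ω)) (ofReal 0) i).unbotD 0

/-- The stationary regime obtained by running the recursion from the remote past. -/
noncomputable def backRegime (θ : Ω ≃ᵐ Ω) (A : ℕ → Ω → RMat k) (ω : Ω) : PR k :=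
  ⟨proj (ofReal (backVec θ A ω)), _, rfl⟩

theorem measurable_backRegime [NeZero k] (hmeas : ∀ n, Measurable (A n)) :
    Measurable (backRegime θ A) := by
  classical
  have hO : ∀ n, MeasurableSet {ω | IsOuter (cocycle A n (θ.symm^[n] ω))} := fun n =>
    (θ.symm.measurable.iterate n) (measurable_cocycle hmeas n measurableSet_isOuter)
  have hT : Measurable (backTime θ A) := by
    refine measurable_to_countable' fun n => ?_
    have hG : MeasurableSet {ω | ∃ n, IsOuter (cocycle A n (θ.symm^[n] ω))} := by
      rw [Set.ofPred_exists]
      exact MeasurableSet.iUnion hO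
    have : backTime θ A ⁻¹' {n} = ({ω | IsOuter (cocycle A n (θ.symm^[n] ω))} ∩
        ⋂ m, ⋂ (_ : m < n), {ω | IsOuter (cocycle A m (θ.symm^[m] ω))}ᶜ) ∪
        ({ω | ∃ n, IsOuter (cocycle A n (θ.symm^[n] ω))}ᶜ ∩ {_ω | n = 0}) := by
      ext ω
      simp only [backTime, Set.mem_preimage, Set.mem_singleton_iff, Set.mem_union, Set.mem_inter_iff,
        Set.mem_iInter, Set.mem_compl_iff, Set.mem_ofPred_eq]
      split_ifs with h
      · rw [Nat.find_eq_iff]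
        simp [h]
      · have h' : ¬ IsOuter (cocycle A n (θ.symm^[n] ω)) := fun h0 => h ⟨n, h0⟩
        simp [h, h', eq_comm]
    rw [this]
    exact ((hO n).inter (MeasurableSet.iInter fun m => MeasurableSet.iInter fun _ =>
      (hO m).compl)).union (hG.compl.inter (MeasurableSet.const _))
  have hV : Measurable (backVec θ A) := by
    have : Measurable fun p : ℕ × Ω => mulVec (cocycle A p.1 (θ.symm^[p.1] p.2)) (ofReal 0) :=
      measurable_from_prod_countable_right fun n =>
        measurable_mulVec ((measurable_cocycle hmeas n).comp (θ.symm.measurable.iterate n)) _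
    exact measurable_pi_iff.2 fun i => measurable_unbotD.comp
      (measurable_pi_iff.1 (this.comp (hT.prodMk measurable_id)) i)
  refine Measurable.subtype_mk (measurable_proj.comp ?_)
  exact measurable_pi_iff.2 fun i => measurable_coe_rmax.comp (measurable_pi_iff.1 hV i)

theorem ae_forall_symm_iterate (hθ : MeasurePreserving θ μ μ) {p : Ω → Prop}
    (h : ∀ᵐ ω ∂μ, p ω) : ∀ᵐ ω ∂μ, ∀ n, p (θ.symm^[n] ω) :=
  ae_all_iff.2 fun n => (hθ.symm.iterate n).quasiMeasurePreserving.ae h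

theorem ae_forall_iterate (hθ : MeasurePreserving θ μ μ) {p : Ω → Prop}
    (h : ∀ᵐ ω ∂μ, p ω) : ∀ᵐ ω ∂μ, ∀ n, p (θ^[n] ω) :=
  ae_all_iff.2 fun n => (hθ.iterate n).quasiMeasurePreserving.ae h

theorem RowFinite.projMul_mem {M : RMat k} (hM : RowFinite M) (z : PR k) :
    projMul M z ∈ PR k := by
  obtain ⟨_, u, rfl⟩ := z
  exact ⟨_, congrArg proj (exists_ofReal_eq (hM.mulVec_ne_bot (ofReal_ne_bot u)))⟩

/-- From any time far enough in the past, the recursion arrives at `backRegime` at time `0`,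
whatever its value at the start. -/
theorem ae_projMul_cocycle_symm_eq_backRegime (hθ : MeasurePreserving θ μ μ)
    (hshift : ∀ n ω, A (n + 1) ω = A n (θ ω)) (hrow : ∀ i, ∀ᵐ ω ∂μ, ∃ j, A 0 ω i j ≠ ⊥)
    (h : ∀ᵐ ω ∂μ, ∃ n, IsOuter (cocycle A n (θ.symm^[n] ω))) :
    ∀ᵐ ω ∂μ, ∀ m, backTime θ A ω ≤ m → ∀ z : PR k,
      projMul (cocycle A m (θ.symm^[m] ω)) z = backRegime θ A ω := by
  classical
  filter_upwards [h, ae_forall_symm_iterate hθ (ae_rowFinite hθ hshift hrow)] with ω h1 h2 m hm z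
  have hout : IsOuter (cocycle A (backTime θ A ω) (θ.symm^[backTime θ A ω] ω)) := by
    rw [show backTime θ A ω = Nat.find h1 by simp [backTime, h1]]
    exact Nat.find_spec h1
  have hreg : (backRegime θ A ω : PRmax k) = projMul (cocycle A (backTime θ A ω)
      (θ.symm^[backTime θ A ω] ω)) ((⟨proj (ofReal 0), _, rfl⟩ : PR k) : PRmax k) := by
    rw [projMul_proj]
    exact congrArg proj (exists_ofReal_eq
      ((rowFinite_prod (h2 _) _).mulVec_ne_bot (ofReal_ne_bot 0)))
  obtain ⟨d, rfl⟩ := Nat.exists_eq_add_of_le' hm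
  rw [cocycle_add hshift, iterate_symm_iterate_add, projMul_mul, hreg]
  exact hout.projMul_eq ⟨_, (rowFinite_prod (h2 _) d).projMul_mem z⟩ _

theorem IsStationaryRegime.ae_iterate (hθ : MeasurePreserving θ μ μ)
    (hshift : ∀ n ω, A (n + 1) ω = A n (θ ω)) {Z : Ω → PR k} (hZ : IsStationaryRegime μ θ A Z) :
    ∀ᵐ ω ∂μ, ∀ n, (Z (θ^[n] ω) : PRmax k) = projMul (cocycle A n ω) (Z ω) := by
  filter_upwards [ae_forall_iterate hθ hZ.2] with ω h n
  induction n with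
  | zero => exact (projMul_idMat _).symm
  | succ n ih =>
    rw [Function.iterate_succ_apply', h, ih, cocycle_add hshift, cocycle_one, projMul_mul]

theorem isUniqueStationaryRegime_backRegime [NeZero k] (hθ : MeasurePreserving θ μ μ)
    (hmeas : ∀ n, Measurable (A n)) (hshift : ∀ n ω, A (n + 1) ω = A n (θ ω))
    (hrow : ∀ i, ∀ᵐ ω ∂μ, ∃ j, A 0 ω i j ≠ ⊥)
    (h : ∀ᵐ ω ∂μ, ∃ n, IsOuter (cocycle A n (θ.symm^[n] ω))) :
    IsUniqueStationaryRegime μ θ A (backRegime θ A) := by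
  have hback := ae_projMul_cocycle_symm_eq_backRegime hθ hshift hrow h
  refine ⟨⟨measurable_backRegime hmeas, ?_⟩, fun Z' hZ' => ?_⟩
  · filter_upwards [hback, hθ.quasiMeasurePreserving.ae hback] with ω h1 h2
    -- Both `Z ω` and `Z (θ ω)` are computed by starting at the same time `-m`.
    set m := max (backTime θ A ω) (backTime θ A (θ ω))
    have e1 := h1 m (le_max_left _ _) (backRegime θ A ω)
    have e2 := h2 (m + 1) ((le_max_right _ _).trans (Nat.le_succ m)) (backRegime θ A ω)
    rw [Function.iterate_succ_apply, θ.symm_apply_apply, cocycle_add hshift, projMul_mul, e1] at e2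
    have e3 := iterate_symm_iterate_add (θ := θ) m 0 ω
    rw [add_zero, Function.iterate_zero_apply] at e3
    rw [← e2, e3, cocycle_one]
  · filter_upwards [hback, ae_forall_symm_iterate hθ (hZ'.ae_iterate hθ hshift)] with ω h1 h2
    have e1 := h1 _ le_rfl (Z' (θ.symm^[backTime θ A ω] ω))
    have e2 := h2 (backTime θ A ω) (backTime θ A ω)
    have e3 := iterate_symm_iterate_add (θ := θ) (backTime θ A ω) 0 ω
    rw [add_zero, Function.iterate_zero_apply] at e3
    rw [e3] at e2
    exact Subtype.ext (e2.trans e1)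

/-- Once `A (n-1) ⊗ ⋯ ⊗ A 0` is of rank 1, all the trajectories agree with the stationary regime. -/
theorem couplesUniformly_of_isOuter [NeZero k] [IsProbabilityMeasure μ]
    (hθ : MeasurePreserving θ μ μ) (hmeas : ∀ n, Measurable (A n))
    (hshift : ∀ n ω, A (n + 1) ω = A n (θ ω)) (hA : Ergodic θ μ ∨ iIndepFun A μ)
    (hrow : ∀ i, ∀ᵐ ω ∂μ, ∃ j, A 0 ω i j ≠ ⊥) {N : ℕ}
    (hpos : 0 < μ {ω | IsOuter (cocycle A N ω)}) : CouplesUniformly μ θ A := by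
  have hfor := ae_exists_isOuter_cocycle hθ hmeas hshift hA hrow hpos
  have hZ := isUniqueStationaryRegime_backRegime hθ hmeas hshift hrow
    (ae_exists_isOuter_cocycle_symm hθ hmeas hfor)
  refine ⟨_, hZ, tendsto_of_tendsto_of_tendsto_of_le_of_le
    (tendsto_measure_isOuter_cocycle hfor) tendsto_const_nhds (fun n => ?_) fun _ => prob_le_one⟩
  refine measure_mono_ae ?_
  filter_upwards [hZ.1.ae_iterate hθ hshift] with ω h1 h2 x₀ l
  rw [h1, traj_eq_mulVec_prod]
  exact (h2 (n + l) (Nat.le_add_right _ _)).projMul_eq ⟨_, x₀, rfl⟩ _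

theorem CouplesUniformly.couples [IsProbabilityMeasure μ] (h : CouplesUniformly μ θ A) :
    Couples μ θ A := by
  obtain ⟨Z, hZ, h⟩ := h
  exact ⟨Z, hZ, fun x₀ => tendsto_of_tendsto_of_tendsto_of_le_of_le h tendsto_const_nhds
    (fun n => measure_mono fun ω hω => hω x₀) fun _ => prob_le_one⟩

theorem HasRankOnePatterns.exists_isOuter (hθ : MeasurePreserving θ μ μ)
    (hshift : ∀ n ω, A (n + 1) ω = A n (θ ω)) (hrow : ∀ i, ∀ᵐ ω ∂μ, ∃ j, A 0 ω i j ≠ ⊥)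
    (h : HasRankOnePatterns μ A) : ∃ N, 0 < μ {ω | IsOuter (cocycle A N ω)} := by
  obtain ⟨C, -, hC, -, N, -, hN⟩ := h
  refine ⟨N, hN.trans_le (measure_mono_ae ?_)⟩
  filter_upwards [ae_rowFinite hθ hshift hrow] with ω h1 h2
  exact (hC _ h2).isOuter (rowFinite_prod h1 N)

/-- The points of the support of the law of a product that are of rank 1 form a set of patterns. -/
theorem hasRankOnePatterns_of_isOuter [NeZero k] (hmeas : ∀ n, Measurable (A n)) {N : ℕ}
    (hN : 1 ≤ N) (hpos : 0 < μ {ω | IsOuter (cocycle A N ω)}) : HasRankOnePatterns μ A := by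
  have hm := measurable_cocycle hmeas N
  obtain ⟨S, hS, hS0, hball⟩ := exists_measurableSet_support (μ.map (cocycle A N))
  refine ⟨{M | IsOuter M} ∩ S, measurableSet_isOuter.inter hS, fun C hC => hC.1.hasRank,
    fun C hC => ⟨N, hN, fun η hη => ?_⟩, N, hN, ?_⟩
  · have := hball C hC.2 η hη
    rwa [Measure.map_apply hm (measurableSet_ball C hη)] at this
  · rw [Measure.map_apply hm hS.compl] at hS0
    refine hpos.trans_le (measure_mono_ae ?_)
    filter_upwards [measure_eq_zero_iff_ae_notMem.1 hS0] with ω h1 h2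
    exact ⟨h2, not_not.1 h1⟩

end Cocycle

/-! ### Matrices of finite projective diameter -/

theorem rowFinite_of_projDiam_lt_top {M : RMat k} (h : projDiam M < ∞) : RowFinite M := by
  classical
  by_contra hM
  have hbot : ¬ ∀ i, mulVec M (ofReal 0) i ≠ ⊥ := by
    intro h0
    refine hM fun i => ?_
    by_contra! hi
    exact h0 i (mulVec_eq_bot.2 fun l => Or.inl (hi l))
  refine absurd h (not_lt.2 ?_)
  unfold projDiam
  refine le_iSup₂_of_le 0 0 ?_
  rw [if_neg fun h0 => hbot h0.1]

theorem ofReal_projDist_le_projDiam {M : RMat k} (hM : RowFinite M) (u v : Fin k → ℝ) :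
    ENNReal.ofReal (projDist (fun i => (mulVec M (ofReal u) i).unbotD 0)
      (fun i => (mulVec M (ofReal v) i).unbotD 0)) ≤ projDiam M := by
  classical
  unfold projDiam
  refine le_iSup₂_of_le u v ?_
  rw [if_pos ⟨hM.mulVec_ne_bot (ofReal_ne_bot u), hM.mulVec_ne_bot (ofReal_ne_bot v)⟩]

theorem sub_add_sub_le_projDist (u v : Fin k → ℝ) (i j : Fin k) :
    (u i - v i) + (v j - u j) ≤ projDist u v :=
  add_le_add (le_ciSup (f := fun i => u i - v i) (Set.finite_range _).bddAbove i)
    (le_ciSup (f := fun i => v i - u i) (Set.finite_range _).bddAbove j)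

/-- In a matrix of finite projective diameter a column with one finite entry is finite. Otherwise,
the images of `0` and of the vector with a large `j`-th entry and `0` elsewhere agree in the row
where the `j`-th column is `-∞`, but are far apart in the row where it is finite. -/
theorem column_ne_bot_of_projDiam_lt_top {M : RMat k} (h : projDiam M < ∞) {i j : Fin k}
    (hij : M i j ≠ ⊥) (i' : Fin k) : M i' j ≠ ⊥ := by
  intro hi'
  have hM := rowFinite_of_projDiam_lt_top h
  obtain ⟨a, ha⟩ := WithBot.ne_bot_iff_exists.1 hij
  let w : ℝ := (mulVec M (ofReal 0) i).unbotD 0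
  let t : ℝ := (projDiam M).toReal + 1 + w - a
  let u : Fin k → ℝ := Pi.single j t
  have hsame : mulVec M (ofReal u) i' = mulVec M (ofReal 0) i' := by
    refine Finset.sup_congr rfl fun l _ => ?_
    by_cases hl : l = j
    · rw [hl, hi', WithBot.bot_add, WithBot.bot_add]
    · simp [ofReal, u, hl]
  have hge : a + t ≤ (mulVec M (ofReal u) i).unbotD 0 := by
    have h1 : M i j + ofReal u j ≤ mulVec M (ofReal u) i :=
      Finset.le_sup (f := fun l => M i l + ofReal u l) (Finset.mem_univ j)
    have h2 := congrFun (exists_ofReal_eq (hM.mulVec_ne_bot (ofReal_ne_bot u))) i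
    rw [← h2, ← ha] at h1
    simp only [ofReal, u, Pi.single_eq_same, ← WithBot.coe_add, WithBot.coe_le_coe] at h1
    exact h1
  have h1 := sub_add_sub_le_projDist (fun i => (mulVec M (ofReal u) i).unbotD 0)
    (fun i => (mulVec M (ofReal 0) i).unbotD 0) i i'
  simp only [hsame, sub_self, add_zero] at h1
  have h2 := ENNReal.toReal_mono h.ne (ofReal_projDist_le_projDiam hM u 0)
  have h3 := le_trans (le_max_left _ _) (ENNReal.toReal_ofReal'.symm.trans_le h2)
  have h4 : a + t - w ≤ (projDiam M).toReal :=
    le_trans (sub_le_sub_right hge w) (h1.trans h3)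
  simp only [t] at h4
  linarith

/-- A vector with a dominant `j`-th entry selects the `j`-th column of a matrix, if this column is
finite. -/
theorem mulVec_single_eq_smul_column {M : RMat k} {j : Fin k} (hj : ∀ i, M i j ≠ ⊥) {K : ℝ}
    (hK : ∀ i l, |(M i l).unbotD 0| ≤ K) :
    mulVec M (ofReal (Pi.single j (2 * K))) = smul ((2 * K : ℝ) : Rmax) (column M j) := by
  funext i
  refine le_antisymm (Finset.sup_le fun l _ => ?_) ?_
  · by_cases hl : l = j
    · subst hl
      simp [ofReal, smul, column, add_comm]
    · obtain ⟨a, ha⟩ := WithBot.ne_bot_iff_exists.1 (hj i)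
      have h1 := abs_le.1 (hK i j)
      have h2 := abs_le.1 (hK i l)
      simp only [ofReal, smul, column, Pi.single_eq_of_ne hl, ← ha, WithBot.unbotD_coe] at h1 ⊢
      generalize M i l = x at h2 ⊢
      induction x using WithBot.recBotCoe with
      | bot => simp
      | coe b =>
        simp only [WithBot.unbotD_coe] at h2
        rw [← WithBot.coe_add, ← WithBot.coe_add, WithBot.coe_le_coe]
        linarith
  · have := Finset.le_sup (f := fun l => M i l + ofReal (Pi.single j (2 * K)) l)
      (Finset.mem_univ j)
    simp only [ofReal, Pi.single_eq_same] at this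
    rw [add_comm] at this
    exact this

/-- If all the images under `Q ⊗ M` of vectors selecting the finite columns of `M` are
parallel, then `Q ⊗ M` is of rank 1. -/
theorem isOuter_mul_of_proj_eq [NeZero k] {M Q : RMat k} (hM : projDiam M < ∞) {K : ℝ}
    (hK : ∀ i l, |(M i l).unbotD 0| ≤ K) {z : PR k}
    (hz : ∀ j, proj (mulVec (mul Q M) (ofReal (Pi.single j (2 * K)))) = (z : PRmax k)) :
    IsOuter (mul Q M) := by
  obtain ⟨_, c, rfl⟩ := z
  have hcol : ∀ j, (∃ i, M i j ≠ ⊥) → ∃ s : ℝ, ∀ t, mul Q M t j = (c t : Rmax) + (s : Rmax) := by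
    rintro j ⟨i, hi⟩
    have h := hz j
    rw [mulVec_mul, mulVec_single_eq_smul_column (column_ne_bot_of_projDiam_lt_top hM hi) hK,
      mulVec_smul] at h
    obtain ⟨a, ha⟩ := proj_eq_proj.1 h
    refine ⟨-(2 * K) + a, fun t => ?_⟩
    have := congrFun ha t
    simp only [smul] at this
    have h2 := coe_add_coe_neg (2 * K) (mulVec Q (column M j) t)
    rw [this] at h2
    rw [WithBot.coe_add, add_comm, add_assoc]
    exact h2.symm
  have hcol' : ∀ j, ∃ s : Rmax, ((∃ i, M i j ≠ ⊥) → s ≠ ⊥) ∧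
      ∀ t, mul Q M t j = (c t : Rmax) + s := by
    intro j
    by_cases hj : ∃ i, M i j ≠ ⊥
    · obtain ⟨s, hs⟩ := hcol j hj
      exact ⟨s, fun _ => WithBot.coe_ne_bot, hs⟩
    · push Not at hj
      refine ⟨⊥, fun ⟨i, hi⟩ => absurd (hj i) hi, fun t => ?_⟩
      rw [WithBot.add_bot]
      exact mulVec_eq_bot.2 fun l => Or.inr (hj l)
  choose r hr hrs using hcol'
  obtain ⟨j, hj⟩ := rowFinite_of_projDiam_lt_top hM 0
  exact ⟨c, r, ⟨j, hr j ⟨0, hj⟩⟩, fun t j => hrs j t⟩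

/-! ### Coupling produces patterns of rank 1 -/

section Coupling

variable {Ω : Type*} [MeasurableSpace Ω] {μ : Measure Ω} {θ : Ω ≃ᵐ Ω} {A : ℕ → Ω → RMat k}

/-- With positive probability, some product has finite projective diameter and bounded finite
entries, and the trajectories started from the `k` vectors that select its finite columns have all
coupled with `Z`; the product is then of rank 1. -/
theorem Couples.exists_isOuter [NeZero k] [IsProbabilityMeasure μ]
    (hmeas : ∀ n, Measurable (A n)) (hshift : ∀ n ω, A (n + 1) ω = A n (θ ω))
    (hdiam : ∃ n : ℕ, 0 < μ {ω | projDiam (cocycle A (n + 1) ω) < ∞}) (h : Couples μ θ A) :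
    ∃ N, 1 ≤ N ∧ 0 < μ {ω | IsOuter (cocycle A N ω)} := by
  obtain ⟨Z, hZ, h⟩ := h
  obtain ⟨m, hm⟩ := hdiam
  obtain ⟨K, hK⟩ : ∃ K : ℕ, 0 < μ {ω | projDiam (cocycle A (m + 1) ω) < ∞ ∧
      ∀ i l, |(cocycle A (m + 1) ω i l).unbotD 0| ≤ (K : ℝ)} := by
    refine exists_measure_pos_of_not_measure_iUnion_null (hm.trans_le (measure_mono ?_)).ne'
    intro ω hω
    obtain ⟨K, hK⟩ := exists_nat_ge
      (∑ i, ∑ l, |(cocycle A (m + 1) ω i l).unbotD 0|)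
    refine Set.mem_iUnion.2 ⟨K, hω, fun i l => le_trans ?_ hK⟩
    refine (Finset.single_le_sum (f := fun l => |(cocycle A (m + 1) ω i l).unbotD 0|)
      (fun _ _ => abs_nonneg _) (Finset.mem_univ l)).trans ?_
    exact Finset.single_le_sum (f := fun i => ∑ l, |(cocycle A (m + 1) ω i l).unbotD 0|)
      (fun _ _ => Finset.sum_nonneg fun _ _ => abs_nonneg _) (Finset.mem_univ i)
  set W := {ω | projDiam (cocycle A (m + 1) ω) < ∞ ∧
      ∀ i l, |(cocycle A (m + 1) ω i l).unbotD 0| ≤ (K : ℝ)}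
  let V : ℕ → Fin k → Set Ω := fun n j =>
    {ω | proj (mulVec (cocycle A n ω) (ofReal (Pi.single j (2 * (K : ℝ))))) =
      (Z (θ^[n] ω) : PRmax k)}
  -- Measurability is needed to pass to complements: `Couples` only controls outer measures.
  have hVm : ∀ n j, MeasurableSet (V n j) := fun n j =>
    measurableSet_proj_eq (measurable_mulVec (measurable_cocycle hmeas n) _)
      (hZ.1.1.comp (θ.measurable.iterate n))
  have hV1 : ∀ j, Tendsto (fun n => μ (V n j)) atTop (𝓝 1) := fun j =>
    tendsto_of_tendsto_of_tendsto_of_le_of_le (h (Pi.single j (2 * (K : ℝ)))) tendsto_const_nhds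
      (fun n => measure_mono fun ω hω => by
        have := hω 0
        rwa [traj_eq_mulVec_prod] at this) fun _ => prob_le_one
  have hV0 : Tendsto (fun n => ∑ j, μ (V n j)ᶜ) atTop (𝓝 0) := by
    have : ∀ j, Tendsto (fun n => μ (V n j)ᶜ) atTop (𝓝 0) := fun j => by
      simp only [fun n => prob_compl_eq_one_sub (μ := μ) (hVm n j)]
      simpa using ENNReal.Tendsto.sub (tendsto_const_nhds (x := (1 : ℝ≥0∞))) (hV1 j)
        (Or.inl ENNReal.one_ne_top)
    simpa using tendsto_finsetSum Finset.univ fun j _ => this j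
  obtain ⟨n, hn, hnm⟩ := ((hV0.eventually (gt_mem_nhds hK)).and
    (eventually_ge_atTop (m + 1))).exists
  refine ⟨n, by omega, ?_⟩
  by_contra h0
  have hsub : W ⊆ {ω | IsOuter (cocycle A n ω)} ∪ ⋃ j, (V n j)ᶜ := by
    intro ω hω
    by_cases hall : ∀ j, ω ∈ V n j
    · refine Or.inl ?_
      obtain ⟨d, rfl⟩ := Nat.exists_eq_add_of_le hnm
      simp only [V, cocycle_add hshift (m + 1) d, Set.mem_ofPred_eq] at hall ⊢
      exact isOuter_mul_of_proj_eq hω.1 hω.2 hall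
    · push Not at hall
      exact Or.inr (Set.mem_iUnion.2 hall)
  have hle : μ W ≤ ∑ j, μ (V n j)ᶜ := by
    refine (measure_mono hsub).trans ((measure_union_le _ _).trans ?_)
    rw [nonpos_iff_eq_zero.1 (not_lt.1 h0), zero_add]
    exact measure_iUnion_fintype_le _ _
  exact absurd hn (not_lt.2 hle)

end Coupling

end MaxPlus

theorem mainTheorem1 {Ω : Type*} [MeasurableSpace Ω] (μ : Measure Ω) [IsProbabilityMeasure μ]
    (θ : Ω ≃ᵐ Ω) (hθ : MeasurePreserving θ μ μ)
    (k : ℕ) (hk : 1 ≤ k)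
    (A : ℕ → Ω → MaxPlus.RMat k) (hmeas : ∀ n, Measurable (A n))
    (hshift : ∀ n ω, A (n + 1) ω = A n (θ ω))
    (hA : Ergodic θ μ ∨ iIndepFun A μ)
    (hrow : ∀ i, ∀ᵐ ω ∂μ, ∃ j, A 0 ω i j ≠ ⊥)
    (hdiam : ∃ n : ℕ, 0 < μ {ω | MaxPlus.projDiam (MaxPlus.prod (fun m => A m ω) (n + 1)) < ∞}) :
    (MaxPlus.Couples μ θ A ↔ MaxPlus.HasRankOnePatterns μ A) ∧
    (MaxPlus.CouplesUniformly μ θ A ↔ MaxPlus.HasRankOnePatterns μ A) := by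
  have : NeZero k := ⟨by omega⟩
  have h13 : MaxPlus.Couples μ θ A → MaxPlus.HasRankOnePatterns μ A := fun h => by
    obtain ⟨N, hN, hpos⟩ := h.exists_isOuter hmeas hshift hdiam
    exact MaxPlus.hasRankOnePatterns_of_isOuter hmeas hN hpos
  have h32 : MaxPlus.HasRankOnePatterns μ A → MaxPlus.CouplesUniformly μ θ A := fun h => by
    obtain ⟨N, hpos⟩ := h.exists_isOuter hθ hshift hrow
    exact MaxPlus.couplesUniformly_of_isOuter hθ hmeas hshift hA hrow hpos
  exact ⟨⟨h13, fun h => (h32 h).couples⟩, ⟨fun h => h13 h.couples, h32⟩⟩
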